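/- For every integer $N\ge 1$ let $n=n(N)\ge N$ and $\overline N=\overline N(N)\ge N$ be integers, put $c_N=N/n$, and assume $$0<\liminf_{N\to\infty} c_N\le\limsup_{N\to\infty} c_N<1 .$$ For every $N$ let $\Theta_1,\dots,\Theta_n$ (depending on $N$) be complex $N\times\overline N$ matrices and $\Omega_i=\Theta_i\Theta_i^*$; assume that $$\inf_N\min_{1\le i\le n}\lambda_{\min}(\Omega_i)>0,\qquad \sup_N\max_{1\le i\le n}\lambda_{\max}(\Omega_i)<+\infty .$$ Let $\mu_N$ be the deterministic equivalent measure, that is, the probability measure on $\mathbb R_+=[0,\infty)$ with Stieltjes transform $$\int\frac{d\mu_N(\lambda)}{\lambda-z}=\frac1N\operatorname{tr}T_N(z),\qquad T_N(z)=\Big(\frac1n\sum_{i=1}^n\frac{\Omega_i}{1+\delta_i(z)}-zI_N\Big)^{-1},\qquad z\in\mathbb C\setminus\mathbb R_+,$$ where $\delta_1,\dots,\delta_n$ are Stieltjes transforms of finite nonnegative measures on $\mathbb R_+$ that satisfy $\delta_i(z)=\frac1n\operatorname{tr}\Omega_iT_N(z)$ for all $i$ and all $z\in\mathbb C\setminus\mathbb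 R_+$. Let $\mathcal S_N$ be the support of $\mu_N$. Then for every $N\ge1$ with $N<n(N)$ one has $0\notin\mathcal S_N$, and there is $\epsilon>0$ with $[0,\epsilon]\cap\mathcal S_N=\emptyset$. Moreover $\epsilon$ can be chosen independently of $N$ for large $N$: there is $\epsilon>0$ such that $[0,\epsilon]\cap\mathcal S_N=\emptyset$ for all sufficiently large $N$. -/

import Mathlib

open Filter MeasureTheory
open scoped Matrix

noncomputable section

namespace CorrelatedGaussian

/-- The covariance matrix `Ω = Θ Θ*` attached to an `N × N'` complex matrix `Θ`. -/
def cov {N N' : ℕ} (Θ : Matrix (Fin N) (Fin N') ℂ) : Matrix (Fin N) (Fin N) ℂ :=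
  Θ * Θᴴ

theorem cov_isHermitian {N N' : ℕ} (Θ : Matrix (Fin N) (Fin N') ℂ) : (cov Θ).IsHermitian :=
  Matrix.isHermitian_mul_conjTranspose_self Θ

/-- `w_min`, the infimum over `N` and `i` of the smallest eigenvalue of `Ω_i`, in the extended
reals (so that no convention about unbounded or empty families interferes). -/
def wMin {n Nbar : ℕ → ℕ}
    (Θ : (N : ℕ) → Fin (n N) → Matrix (Fin N) (Fin (Nbar N)) ℂ) : EReal :=
  ⨅ (N : ℕ) (i : Fin (n N)) (j : Fin N), (((cov_isHermitian (Θ N i)).eigenvalues j : ℝ) : EReal)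

/-- `w_max`, the supremum over `N` and `i` of the largest eigenvalue of `Ω_i`. -/
def wMax {n Nbar : ℕ → ℕ}
    (Θ : (N : ℕ) → Fin (n N) → Matrix (Fin N) (Fin (Nbar N)) ℂ) : EReal :=
  ⨆ (N : ℕ) (i : Fin (n N)) (j : Fin N), (((cov_isHermitian (Θ N i)).eigenvalues j : ℝ) : EReal)

/-- The Stieltjes transform `z ↦ ∫ dμ(x) / (x - z)`. -/
def stieltjes (μ : Measure ℝ) (z : ℂ) : ℂ :=
  ∫ x : ℝ, ((x : ℂ) - z)⁻¹ ∂μ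

/-- The slit plane `ℂ \ ℝ₊`, with `ℝ₊ = [0, ∞)`. -/
def offRPlus : Set ℂ :=
  {z : ℂ | ¬ ∃ x : ℝ, 0 ≤ x ∧ z = (x : ℂ)}

/-- `T(z) = ((1/n) ∑ᵢ Ωᵢ / (1 + dᵢ) - z I)⁻¹`, for given values `dᵢ` of `δᵢ(z)`. -/
def matT {n N : ℕ} (Ω : Fin n → Matrix (Fin N) (Fin N) ℂ) (d : Fin n → ℂ) (z : ℂ) :
    Matrix (Fin N) (Fin N) ℂ :=
  ((1 / (n : ℂ)) • ∑ i, (1 / (1 + d i)) • Ω i - z • (1 : Matrix (Fin N) (Fin N) ℂ))⁻¹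

/-- `δ₁, …, δₙ` are Stieltjes transforms of finite nonnegative measures carried by `ℝ₊` and solve
`δᵢ(z) = (1/n) tr Ωᵢ T(z)` for every `z ∈ ℂ \ ℝ₊`. -/
structure IsFixedPointSystem {n N : ℕ} (Ω : Fin n → Matrix (Fin N) (Fin N) ℂ)
    (δ : Fin n → ℂ → ℂ) : Prop where
  stieltjes_repr : ∀ i, ∃ ν : Measure ℝ, IsFiniteMeasure ν ∧ ν (Set.Iio 0) = 0 ∧
    ∀ z ∈ offRPlus, δ i z = stieltjes ν z
  fixed_point : ∀ i, ∀ z ∈ offRPlus,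
    δ i z = (1 / (n : ℂ)) * (Ω i * matT Ω (fun j => δ j z) z).trace

/-- `μ` is the deterministic equivalent measure of the covariances `Ω₁, …, Ωₙ`: the probability
measure on `ℝ₊` whose Stieltjes transform is `m(z) = (1/N) tr T(z)`. -/
structure IsDeterministicEquivalent {n N : ℕ} (Ω : Fin n → Matrix (Fin N) (Fin N) ℂ)
    (μ : Measure ℝ) : Prop where
  isProbabilityMeasure : IsProbabilityMeasure μ
  carried : μ (Set.Iio 0) = 0
  stieltjes_eq : ∃ δ : Fin n → ℂ → ℂ, IsFixedPointSystem Ω δ ∧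
    ∀ z ∈ offRPlus, stieltjes μ z = (1 / (N : ℂ)) * (matT Ω (fun j => δ j z) z).trace

end CorrelatedGaussian

end

noncomputable section

namespace CorrelatedGaussian

open scoped ComplexOrder MatrixOrder

/-! Write `z = x + iy` with `y > 0`, `c = N/n`, and let `t² = ‖T‖_F² / n`. It suffices to show `Im
tr T = O(y)` uniformly above `[0, ε]`: the Poisson kernel then shows that the measure has no mass
there (`measure_Ico_eq_zero`).

Expanding `T = T (T⁻¹)* T*` shows that `Im δ` and `1 + Re δ` solve linear systems with one and the
same nonnegative matrix, with sources `y b` and `1 - x b`, where `bᵢ = n⁻¹ tr Ωᵢ T T*`. If `x b ≤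
1/2`, comparing the two systems (`le_of_nonneg_system`) gives `Im δ = O(y)`, hence `im_trace_le`.
Since `b ≤ W t²`, only a bound on `t` is missing.

That bound is a continuity argument. The inequality `w t (1 - c - |z| t) ≤ 1` of
`sqrt_frobSq_mul_le` forbids the value `t = 2 / (w (1 - c))` when `|z|` is small. On the imaginary
axis `t ≤ 1 / (w (1 - c))`, so along a horizontal segment `t` stays below the barrier. The resulting
`ε` depends only on `w`, `W` and a lower bound for `1 - c`; the constant in `O(y)` may depend on
`N`. -/

/-! ### Trace inequalities and the Frobenius norm. -/

theorem trace_mul_nonneg {N : ℕ} {P Q : Matrix (Fin N) (Fin N) ℂ}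
    (hP : P.PosSemidef) (hQ : Q.PosSemidef) : 0 ≤ (P * Q).trace := by
  obtain ⟨C, rfl⟩ := CStarAlgebra.nonneg_iff_eq_star_mul_self.mp hP.nonneg
  rw [mul_assoc, Matrix.trace_mul_comm]
  exact (hQ.mul_mul_conjTranspose_same C).trace_nonneg

theorem re_trace_mul_le {N : ℕ} {A B Q : Matrix (Fin N) (Fin N) ℂ}
    (h : (B - A).PosSemidef) (hQ : Q.PosSemidef) : (A * Q).trace.re ≤ (B * Q).trace.re := by
  have := (Complex.le_def.1 (trace_mul_nonneg h hQ)).1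
  rw [sub_mul, Matrix.trace_sub, Complex.sub_re, Complex.zero_re] at this
  linarith

/-- The squared Frobenius norm. -/
def frobSq {N : ℕ} (T : Matrix (Fin N) (Fin N) ℂ) : ℝ := ∑ i, ∑ j, ‖T i j‖ ^ 2

theorem trace_mul_conjTranspose {N : ℕ} (T : Matrix (Fin N) (Fin N) ℂ) :
    (T * Tᴴ).trace = (frobSq T : ℂ) := by
  simp [frobSq, Matrix.trace, Matrix.mul_apply, Complex.mul_conj']

theorem trace_conjTranspose_mul {N : ℕ} (T : Matrix (Fin N) (Fin N) ℂ) :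
    (Tᴴ * T).trace = (frobSq T : ℂ) := by
  rw [Matrix.trace_mul_comm, trace_mul_conjTranspose]

theorem norm_trace_sq_le {N : ℕ} (T : Matrix (Fin N) (Fin N) ℂ) :
    ‖T.trace‖ ^ 2 ≤ N * frobSq T := by
  have h1 : ‖T.trace‖ ≤ ∑ i, ‖T i i‖ := norm_sum_le _ _
  have h2 := sq_sum_le_card_mul_sum_sq (s := Finset.univ) (f := fun i => ‖T i i‖)
  have h3 : ∑ i, ‖T i i‖ ^ 2 ≤ frobSq T := Finset.sum_le_sum fun i _ =>
    Finset.single_le_sum (f := fun j => ‖T i j‖ ^ 2) (fun j _ => by positivity) (Finset.mem_univ i)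
  simp only [Finset.card_univ, Fintype.card_fin] at h2
  calc ‖T.trace‖ ^ 2 ≤ (∑ i, ‖T i i‖) ^ 2 := by gcongr
    _ ≤ _ := h2
    _ ≤ _ := by gcongr

theorem frobSq_pos {N : ℕ} (hN : 0 < N) {T : Matrix (Fin N) (Fin N) ℂ} (hT : IsUnit T) :
    0 < frobSq T := by
  have h0 : 0 ≤ frobSq T := by unfold frobSq; positivity
  refine h0.lt_of_ne fun h => ?_
  have : (T * Tᴴ).trace = 0 := by rw [trace_mul_conjTranspose, ← h]; simp
  rw [Matrix.trace_mul_conjTranspose_self_eq_zero_iff] at this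
  subst this
  have : Nonempty (Fin N) := ⟨⟨0, hN⟩⟩
  exact not_isUnit_zero hT

/-- Expand `0 ≤ ‖T - A‖_F²`. -/
theorem two_mul_re_trace_mul_le {N : ℕ} {A : Matrix (Fin N) (Fin N) ℂ} (hA : A.IsHermitian)
    (T : Matrix (Fin N) (Fin N) ℂ) : 2 * (A * T).trace.re ≤ frobSq T + frobSq A := by
  have h : 0 ≤ frobSq (T - A) := by unfold frobSq; positivity
  have e : ((frobSq (T - A) : ℝ) : ℂ)
      = frobSq T + frobSq A - ((A * T).trace + star (A * T).trace) := by
    rw [← trace_mul_conjTranspose, ← trace_mul_conjTranspose, ← trace_mul_conjTranspose,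
      ← Matrix.trace_conjTranspose, Matrix.conjTranspose_mul, Matrix.conjTranspose_sub, hA.eq,
      sub_mul, mul_sub, mul_sub, Matrix.trace_sub, Matrix.trace_sub, Matrix.trace_sub,
      Matrix.trace_mul_comm T A, Matrix.trace_mul_comm Tᴴ A]
    ring
  have := congrArg Complex.re e
  simp at this
  linarith

/-! ### Invertibility and trace identities for `T`. -/

/-- The matrix whose inverse is `matT`. -/
def matM {n N : ℕ} (Ω : Fin n → Matrix (Fin N) (Fin N) ℂ) (d : Fin n → ℂ) (z : ℂ) :
    Matrix (Fin N) (Fin N) ℂ :=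
  (1 / (n : ℂ)) • ∑ i, (1 / (1 + d i)) • Ω i - z • (1 : Matrix (Fin N) (Fin N) ℂ)

theorem matT_eq {n N : ℕ} (Ω : Fin n → Matrix (Fin N) (Fin N) ℂ) (d : Fin n → ℂ) (z : ℂ) :
    matT Ω d z = (matM Ω d z)⁻¹ := rfl

theorem im_one_div_one_add_nonpos {d : ℂ} (hd : 0 ≤ d.im) : (1 / (1 + d)).im ≤ 0 := by
  rw [one_div, Complex.inv_im]
  exact div_nonpos_of_nonpos_of_nonneg (by simpa using hd) (Complex.normSq_nonneg _)

/-- A kernel vector `v` would make `v* M v` vanish, but its imaginary part is negative: the `Ωᵢ`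
terms contribute at most `0` and `-z v* v` strictly less. -/
theorem isUnit_matM {n N : ℕ} {Ω : Fin n → Matrix (Fin N) (Fin N) ℂ} {d : Fin n → ℂ} {z : ℂ}
    (hΩ : ∀ i, (Ω i).PosSemidef) (hd : ∀ i, 0 ≤ (d i).im) (hz : 0 < z.im) :
    IsUnit (matM Ω d z) := by
  rw [Matrix.isUnit_iff_isUnit_det, isUnit_iff_ne_zero]
  intro h
  obtain ⟨v, hv, hv0⟩ := Matrix.exists_mulVec_eq_zero_iff.2 h
  have key : star v ⬝ᵥ (matM Ω d z *ᵥ v)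
      = (1 / (n : ℂ)) * ∑ i, (1 / (1 + d i)) * (star v ⬝ᵥ (Ω i *ᵥ v)) - z * (star v ⬝ᵥ v) := by
    simp only [matM, Matrix.sub_mulVec, Matrix.smul_mulVec, Matrix.sum_mulVec, dotProduct_sub,
      dotProduct_smul, dotProduct_sum, Matrix.one_mulVec, smul_eq_mul]
  rw [hv0, dotProduct_zero] at key
  have key := congrArg Complex.im key
  have hv2 : 0 < star v ⬝ᵥ v := Matrix.dotProduct_star_self_pos_iff.2 hv
  have e1 : ∀ i, ((1 / (1 + d i)) * (star v ⬝ᵥ (Ω i *ᵥ v))).im ≤ 0 := fun i => by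
    obtain ⟨h1, h2⟩ := Complex.le_def.1 ((hΩ i).dotProduct_mulVec_nonneg v)
    rw [Complex.mul_im, ← h2, Complex.zero_im, mul_zero, zero_add]
    exact mul_nonpos_of_nonpos_of_nonneg (im_one_div_one_add_nonpos (hd i)) h1
  obtain ⟨h1, h2⟩ := Complex.lt_def.1 hv2
  have e2 : ((1 / (n : ℂ)) * ∑ i, (1 / (1 + d i)) * (star v ⬝ᵥ (Ω i *ᵥ v))).im ≤ 0 := by
    have : (1 / (n : ℂ)) = ((1 / (n : ℝ) : ℝ) : ℂ) := by push_cast; rfl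
    rw [this, Complex.im_ofReal_mul, Complex.im_sum]
    exact mul_nonpos_of_nonneg_of_nonpos (by positivity) (Finset.sum_nonpos fun i _ => e1 i)
  rw [Complex.sub_im, Complex.mul_im z, ← h2] at key
  have := mul_pos hz h1
  simp only [Complex.zero_re, Complex.zero_im] at *
  linarith

/-- `tr P T = n⁻¹ ∑ⱼ conj (1 / (1 + dⱼ)) tr (P T Ωⱼ T*) - conj z tr (P T T*)`. -/
theorem trace_mul_matT {n N : ℕ} {Ω : Fin n → Matrix (Fin N) (Fin N) ℂ} {d : Fin n → ℂ} {z : ℂ}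
    (hΩ : ∀ i, (Ω i).PosSemidef) (hM : IsUnit (matM Ω d z)) (P : Matrix (Fin N) (Fin N) ℂ) :
    (P * matT Ω d z).trace = (1 / (n : ℂ)) * ∑ j, star (1 / (1 + d j)) *
        (P * (matT Ω d z * Ω j * (matT Ω d z)ᴴ)).trace
      - star z * (P * (matT Ω d z * (matT Ω d z)ᴴ)).trace := by
  set T := matT Ω d z with hT
  -- Expanding the middle factor turns `T` into a combination of the positive semidefinite matrices
  -- `T Ωⱼ T*` and `T T*`.
  have h1 : T * (matM Ω d z)ᴴ * Tᴴ = T := by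
    rw [mul_assoc, ← Matrix.conjTranspose_mul, hT, matT_eq,
      Matrix.nonsing_inv_mul _ ((Matrix.isUnit_iff_isUnit_det _).1 hM)]
    simp
  have h2 : (matM Ω d z)ᴴ = (1 / (n : ℂ)) • ∑ j, star (1 / (1 + d j)) • Ω j
      - star z • (1 : Matrix (Fin N) (Fin N) ℂ) := by
    simp [matM, Matrix.conjTranspose_sub, Matrix.conjTranspose_smul, Matrix.conjTranspose_sum,
      fun j => (hΩ j).isHermitian.eq]
  conv_lhs => rw [← h1, h2]
  simp only [mul_sub, sub_mul, Matrix.mul_smul, Matrix.smul_mul, Finset.mul_sum, Finset.sum_mul,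
    Matrix.trace_sub, Matrix.trace_smul, Matrix.trace_sum, smul_eq_mul, mul_one]

/-- Trace form of `T⁻¹ T = 1`. -/
theorem sum_one_div_mul_trace {n N : ℕ} {Ω : Fin n → Matrix (Fin N) (Fin N) ℂ} {d : Fin n → ℂ}
    {z : ℂ} (hM : IsUnit (matM Ω d z)) :
    ∑ j, (1 / (1 + d j)) * ((1 / (n : ℂ)) * (Ω j * matT Ω d z).trace)
      - z * (matT Ω d z).trace = N := by
  have h := congrArg Matrix.trace
    (Matrix.mul_nonsing_inv _ ((Matrix.isUnit_iff_isUnit_det _).1 hM))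
  rw [← matT_eq, Matrix.trace_one, Fintype.card_fin, matM] at h
  simp only [sub_mul, Matrix.smul_mul, Finset.sum_mul,
    Matrix.trace_sub, Matrix.trace_smul, Matrix.trace_sum, smul_eq_mul, one_mul] at h
  rw [← h, Finset.mul_sum]
  congr 1
  refine Finset.sum_congr rfl fun j _ => by ring

/-! ### Eigenvalue bounds as Loewner inequalities. -/

theorem posSemidef_affine {N : ℕ} {A : Matrix (Fin N) (Fin N) ℂ} (hA : A.IsHermitian)
    {a b : ℝ} (h : ∀ j, 0 ≤ a * hA.eigenvalues j + b) :
    ((a : ℂ) • A + (b : ℂ) • (1 : Matrix (Fin N) (Fin N) ℂ)).PosSemidef := by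
  have e : (a : ℂ) • A + (b : ℂ) • (1 : Matrix (Fin N) (Fin N) ℂ)
      = (hA.eigenvectorUnitary : Matrix (Fin N) (Fin N) ℂ) *
        (Matrix.diagonal fun j => ((a * hA.eigenvalues j + b : ℝ) : ℂ)) *
        (hA.eigenvectorUnitary : Matrix (Fin N) (Fin N) ℂ)ᴴ := by
    have h1 := hA.spectral_theorem
    rw [Unitary.conjStarAlgAut_apply] at h1
    have h2 : (hA.eigenvectorUnitary : Matrix (Fin N) (Fin N) ℂ) *
      (hA.eigenvectorUnitary : Matrix (Fin N) (Fin N) ℂ)ᴴ = 1 :=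
      Unitary.mul_star_self_of_mem hA.eigenvectorUnitary.2
    have h3 : (Matrix.diagonal fun j => ((a * hA.eigenvalues j + b : ℝ) : ℂ))
      = (a : ℂ) • Matrix.diagonal (RCLike.ofReal ∘ hA.eigenvalues) + (b : ℂ) • 1 := by
      ext i j
      by_cases hij : i = j
      · subst hij; simp
      · simp [hij]
    rw [h3, mul_add, add_mul, Matrix.mul_smul, Matrix.smul_mul, Matrix.mul_smul, Matrix.smul_mul,
      mul_one, h2]
    conv_lhs => rw [h1]
    rfl
  rw [e]
  refine Matrix.PosSemidef.mul_mul_conjTranspose_same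
    (Matrix.posSemidef_diagonal_iff.2 fun j => ?_) _
  rw [Complex.zero_le_real]
  exact h j

theorem posSemidef_sub_smul_one {N : ℕ} {A : Matrix (Fin N) (Fin N) ℂ} (hA : A.IsHermitian)
    {w : ℝ} (h : ∀ j, w ≤ hA.eigenvalues j) :
    (A - (w : ℂ) • (1 : Matrix (Fin N) (Fin N) ℂ)).PosSemidef := by
  have := posSemidef_affine hA (a := 1) (b := -w) fun j => by linarith [h j]
  simpa [sub_eq_add_neg] using this

theorem posSemidef_smul_one_sub {N : ℕ} {A : Matrix (Fin N) (Fin N) ℂ} (hA : A.IsHermitian)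
    {w : ℝ} (h : ∀ j, hA.eigenvalues j ≤ w) :
    ((w : ℂ) • (1 : Matrix (Fin N) (Fin N) ℂ) - A).PosSemidef := by
  have := posSemidef_affine hA (a := -1) (b := w) fun j => by linarith [h j]
  simpa [sub_eq_neg_add] using this

/-! ### A priori bounds for a solution at one point. -/

/-- `d` solves the fixed point equations at the point `z` of the upper half plane, with
covariances between `w` and `W`. -/
structure IsSolutionAt {n N : ℕ} (Ω : Fin n → Matrix (Fin N) (Fin N) ℂ) (w W : ℝ)
    (d : Fin n → ℂ) (z : ℂ) : Prop where
  w_pos : 0 < w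
  lower : ∀ i, (Ω i - (w : ℂ) • (1 : Matrix (Fin N) (Fin N) ℂ)).PosSemidef
  upper : ∀ i, ((W : ℂ) • (1 : Matrix (Fin N) (Fin N) ℂ) - Ω i).PosSemidef
  im_nonneg : ∀ i, 0 ≤ (d i).im
  im_pos : 0 < z.im
  fixed_point : ∀ i, d i = (1 / (n : ℂ)) * (Ω i * matT Ω d z).trace

namespace IsSolutionAt

variable {n N : ℕ} {Ω : Fin n → Matrix (Fin N) (Fin N) ℂ} {w W : ℝ} {d : Fin n → ℂ} {z : ℂ}

theorem posSemidef (h : IsSolutionAt Ω w W d z) (i : Fin n) : (Ω i).PosSemidef := by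
  have h1 : ((w : ℂ) • (1 : Matrix (Fin N) (Fin N) ℂ)).PosSemidef :=
    Matrix.PosSemidef.one.smul (Complex.zero_le_real.2 h.w_pos.le)
  simpa using (h.lower i).add h1

theorem isUnit_matM (h : IsSolutionAt Ω w W d z) : IsUnit (matM Ω d z) :=
  CorrelatedGaussian.isUnit_matM h.posSemidef h.im_nonneg h.im_pos

theorem isUnit_matT (h : IsSolutionAt Ω w W d z) : IsUnit (matT Ω d z) :=
  (Matrix.isUnit_nonsing_inv_iff).2 h.isUnit_matM

theorem sandwich_posSemidef (h : IsSolutionAt Ω w W d z) (j : Fin n) :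
    (matT Ω d z * Ω j * (matT Ω d z)ᴴ).PosSemidef :=
  (h.posSemidef j).mul_mul_conjTranspose_same _

theorem mul_conjTranspose_posSemidef (T : Matrix (Fin N) (Fin N) ℂ) : (T * Tᴴ).PosSemidef :=
  Matrix.posSemidef_self_mul_conjTranspose T

theorem re_one_div (e : ℂ) :
    (1 / (1 + e)).re = (Complex.normSq (1 + e))⁻¹ * (1 + e.re) := by
  simp [Complex.inv_re, div_eq_inv_mul]

theorem star_one_div (e : ℂ) :
    star (1 / (1 + e)) = (((Complex.normSq (1 + e))⁻¹ * (1 + e.re) : ℝ) : ℂ)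
      + (((Complex.normSq (1 + e))⁻¹ * e.im : ℝ) : ℂ) * Complex.I := by
  apply Complex.ext
  · rw [Complex.star_def, Complex.conj_re, re_one_div]
    simp
  · rw [Complex.star_def, Complex.conj_im, one_div, Complex.inv_im]
    rw [Complex.add_im, Complex.one_im, Complex.add_im, Complex.ofReal_im, Complex.im_ofReal_mul,
      Complex.I_im]
    ring

theorem trace_eq_re {P Q : Matrix (Fin N) (Fin N) ℂ} (hP : P.PosSemidef) (hQ : Q.PosSemidef) :
    (P * Q).trace = (((P * Q).trace.re : ℝ) : ℂ) :=
  Complex.ext (by simp) (by simpa using (Complex.le_def.1 (trace_mul_nonneg hP hQ)).2.symm)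

/-- For `P ≥ 0` all traces on the right of `trace_mul_matT` are real, so only the scalar
coefficients have to be split. The weights `|1 + dⱼ|⁻²` are the same here and in
`re_trace_mul_matT`, which is what makes the two systems comparable. -/
theorem im_trace_mul_matT (h : IsSolutionAt Ω w W d z) {P : Matrix (Fin N) (Fin N) ℂ}
    (hP : P.PosSemidef) :
    (P * matT Ω d z).trace.im = (1 / (n : ℝ)) * ∑ j, (Complex.normSq (1 + d j))⁻¹ * (d j).im *
        (P * (matT Ω d z * Ω j * (matT Ω d z)ᴴ)).trace.re
      + z.im * (P * (matT Ω d z * (matT Ω d z)ᴴ)).trace.re := by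
  have hn : (1 / (n : ℂ)) = ((1 / (n : ℝ) : ℝ) : ℂ) := by push_cast; rfl
  rw [trace_mul_matT h.posSemidef h.isUnit_matM P,
    trace_eq_re hP (mul_conjTranspose_posSemidef (matT Ω d z)), hn, Complex.sub_im,
    Complex.im_ofReal_mul, Complex.im_mul_ofReal, Complex.im_sum]
  simp_rw [star_one_div]
  have : ∀ j, ∀ c : ℂ, (c * (P * (matT Ω d z * Ω j * (matT Ω d z)ᴴ)).trace).im
      = c.im * (P * (matT Ω d z * Ω j * (matT Ω d z)ᴴ)).trace.re := fun j c => by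
    rw [trace_eq_re hP (h.sandwich_posSemidef j), Complex.im_mul_ofReal, Complex.ofReal_re]
  simp_rw [this]
  simp

theorem re_trace_mul_matT (h : IsSolutionAt Ω w W d z) {P : Matrix (Fin N) (Fin N) ℂ}
    (hP : P.PosSemidef) :
    (P * matT Ω d z).trace.re =
      (1 / (n : ℝ)) * ∑ j, (Complex.normSq (1 + d j))⁻¹ * (1 + (d j).re) *
        (P * (matT Ω d z * Ω j * (matT Ω d z)ᴴ)).trace.re
      - z.re * (P * (matT Ω d z * (matT Ω d z)ᴴ)).trace.re := by
  have hn : (1 / (n : ℂ)) = ((1 / (n : ℝ) : ℝ) : ℂ) := by push_cast; rfl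
  rw [trace_mul_matT h.posSemidef h.isUnit_matM P,
    trace_eq_re hP (mul_conjTranspose_posSemidef (matT Ω d z)), hn, Complex.sub_re,
    Complex.re_ofReal_mul, Complex.re_mul_ofReal, Complex.re_sum]
  simp_rw [star_one_div]
  have : ∀ j, ∀ c : ℂ, (c * (P * (matT Ω d z * Ω j * (matT Ω d z)ᴴ)).trace).re
      = c.re * (P * (matT Ω d z * Ω j * (matT Ω d z)ᴴ)).trace.re := fun j c => by
    rw [trace_eq_re hP (h.sandwich_posSemidef j), Complex.re_mul_ofReal, Complex.ofReal_re]
  simp_rw [this]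
  simp

theorem im_trace_mul_matT_ge (h : IsSolutionAt Ω w W d z) {P : Matrix (Fin N) (Fin N) ℂ}
    (hP : P.PosSemidef) :
    z.im * (P * (matT Ω d z * (matT Ω d z)ᴴ)).trace.re ≤ (P * matT Ω d z).trace.im := by
  rw [h.im_trace_mul_matT hP, le_add_iff_nonneg_left]
  refine mul_nonneg (by positivity) (Finset.sum_nonneg fun j _ => mul_nonneg (mul_nonneg
    (inv_nonneg.2 (Complex.normSq_nonneg _)) (h.im_nonneg j)) ?_)
  exact (Complex.le_def.1 (trace_mul_nonneg hP (h.sandwich_posSemidef j))).1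

theorem frobSq_pos (h : IsSolutionAt Ω w W d z) (hN : 0 < N) : 0 < frobSq (matT Ω d z) :=
  CorrelatedGaussian.frobSq_pos hN h.isUnit_matT

theorem im_trace_pos (h : IsSolutionAt Ω w W d z) (hN : 0 < N) :
    0 < (matT Ω d z).trace.im := by
  have h1 := h.im_trace_mul_matT_ge Matrix.PosSemidef.one
  rw [one_mul, one_mul, trace_mul_conjTranspose, Complex.ofReal_re] at h1
  exact (mul_pos h.im_pos (h.frobSq_pos hN)).trans_le h1

/-- Apply `im_trace_mul_matT_ge` to `P = Ωᵢ - w ≥ 0`. -/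
theorem im_ge (h : IsSolutionAt Ω w W d z) (i : Fin n) :
    w / n * (matT Ω d z).trace.im ≤ (d i).im := by
  have h1 : 0 ≤ ((Ω i - (w : ℂ) • (1 : Matrix (Fin N) (Fin N) ℂ)) * matT Ω d z).trace.im := by
    refine le_trans (mul_nonneg h.im_pos.le ?_) (h.im_trace_mul_matT_ge (h.lower i))
    exact (Complex.le_def.1 (trace_mul_nonneg (h.lower i) (mul_conjTranspose_posSemidef _))).1
  rw [sub_mul, Matrix.trace_sub, Matrix.smul_mul, Matrix.trace_smul, one_mul, smul_eq_mul,
    Complex.sub_im, Complex.im_ofReal_mul, sub_nonneg] at h1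
  have hn : (1 / (n : ℂ)) = ((1 / (n : ℝ) : ℝ) : ℂ) := by push_cast; rfl
  rw [h.fixed_point i, hn, Complex.im_ofReal_mul]
  calc w / n * (matT Ω d z).trace.im = 1 / (n : ℝ) * (w * (matT Ω d z).trace.im) := by ring
    _ ≤ _ := by gcongr

theorem im_pos' (h : IsSolutionAt Ω w W d z) (hN : 0 < N) (i : Fin n) : 0 < (d i).im := by
  have hn : 0 < n := i.pos
  have := h.w_pos
  exact (mul_pos (by positivity) (h.im_trace_pos hN)).trans_le (h.im_ge i)

theorem one_add_ne_zero (h : IsSolutionAt Ω w W d z) (hN : 0 < N) (j : Fin n) :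
    1 + d j ≠ 0 := fun h0 => by
  have h2 := congrArg Complex.im h0
  simp only [Complex.add_im, Complex.one_im, Complex.zero_im, zero_add] at h2
  exact (h.im_pos' hN j).ne' h2

theorem sandwich_trace_ge (h : IsSolutionAt Ω w W d z) (j : Fin n) :
    w * frobSq (matT Ω d z) ≤ (matT Ω d z * Ω j * (matT Ω d z)ᴴ).trace.re := by
  have h1 := re_trace_mul_le (h.lower j)
    (Matrix.posSemidef_conjTranspose_mul_self (matT Ω d z))
  rw [Matrix.smul_mul, Matrix.trace_smul, one_mul, trace_conjTranspose_mul, smul_eq_mul,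
    ← Complex.ofReal_mul, Complex.ofReal_re] at h1
  refine h1.trans_eq ?_
  rw [← mul_assoc, Matrix.trace_mul_comm, ← mul_assoc]

/-- `w² (F / n) avg |1 + dⱼ|⁻² ≤ 1`. -/
theorem frobSq_mul_sum_le (h : IsSolutionAt Ω w W d z) (hN : 0 < N) :
    w ^ 2 * frobSq (matT Ω d z) * ∑ j, (Complex.normSq (1 + d j))⁻¹ ≤ (n : ℝ) ^ 2 := by
  rcases Nat.eq_zero_or_pos n with hn | hn
  · subst hn; simp
  have hn' : (0 : ℝ) < n := by exact_mod_cast hn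
  set F := frobSq (matT Ω d z) with hF
  set V := (matT Ω d z).trace.im with hV
  have hV0 : 0 < V := h.im_trace_pos hN
  have hF0 : 0 < F := h.frobSq_pos hN
  have hw := h.w_pos
  have h1 := h.im_trace_mul_matT Matrix.PosSemidef.one
  simp only [one_mul] at h1
  rw [trace_mul_conjTranspose, Complex.ofReal_re, ← hV, ← hF] at h1
  -- By `im_ge`, `V = Im tr T` bounds each `Im dⱼ` from below, so it occurs on both sides and
  -- cancels.
  have h2 : (1 / (n : ℝ)) * ∑ j, (Complex.normSq (1 + d j))⁻¹ * (w / n * V) * (w * F) ≤ V := by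
    refine le_trans ?_ h1.ge
    refine le_trans ?_ (le_add_of_nonneg_right (mul_nonneg h.im_pos.le hF0.le))
    gcongr with j
    · exact mul_nonneg (inv_nonneg.2 (Complex.normSq_nonneg _)) (h.im_nonneg j)
    · exact inv_nonneg.2 (Complex.normSq_nonneg _)
    · exact h.im_ge j
    · exact h.sandwich_trace_ge j
  rw [← Finset.sum_mul, ← Finset.sum_mul] at h2
  have h3 : V * (w ^ 2 * F * ∑ j, (Complex.normSq (1 + d j))⁻¹) ≤ V * (n : ℝ) ^ 2 := by
    calc _ = (n : ℝ) ^ 2 * ((1 / (n : ℝ)) *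
          ((∑ j, (Complex.normSq (1 + d j))⁻¹) * (w / n * V) * (w * F))) := by field_simp
      _ ≤ (n : ℝ) ^ 2 * V := by gcongr
      _ = _ := mul_comm _ _
  exact le_of_mul_le_mul_left h3 hV0

/-- The fixed point equations turn the trace of `T⁻¹ T = 1` into a sum of `dⱼ / (1 + dⱼ) = 1 - 1 /
(1 + dⱼ)`. -/
theorem sum_re_one_div (h : IsSolutionAt Ω w W d z) (hN : 0 < N) :
    ∑ j, (1 / (1 + d j)).re = n - N - (z * (matT Ω d z).trace).re := by
  have h1 := sum_one_div_mul_trace h.isUnit_matM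
  simp_rw [← h.fixed_point] at h1
  have h2 : ∀ j, (1 / (1 + d j)) * d j = 1 - 1 / (1 + d j) := fun j => by
    have := h.one_add_ne_zero hN j
    field_simp
    ring
  simp_rw [h2, Finset.sum_sub_distrib] at h1
  have := congrArg Complex.re h1
  simp only [Finset.sum_const, Finset.card_univ, Fintype.card_fin, nsmul_eq_mul, mul_one,
    Complex.sub_re, Complex.natCast_re, Complex.re_sum] at this
  linarith

theorem norm_trace_le (hNn : N ≤ n) (T : Matrix (Fin N) (Fin N) ℂ) :
    ‖T.trace‖ ≤ n * √(frobSq T / n) := by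
  rcases Nat.eq_zero_or_pos n with hn | hn
  · subst hn
    obtain rfl : N = 0 := by omega
    simp [Matrix.trace]
  have h1 := norm_trace_sq_le T
  have hn' : (0 : ℝ) < n := by exact_mod_cast hn
  have h0 : 0 ≤ frobSq T := by unfold frobSq; positivity
  refine abs_le_of_sq_le_sq' ?_ (by positivity) |>.2
  rw [mul_pow, Real.sq_sqrt (by positivity)]
  calc _ ≤ _ := h1
    _ ≤ n * frobSq T := by gcongr
    _ = _ := by field_simp

/-- The a priori inequality for the normalised Frobenius norm `t` of `T`. -/
theorem sqrt_frobSq_mul_le (h : IsSolutionAt Ω w W d z) (hN : 0 < N) (hNn : N ≤ n) :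
    w * √(frobSq (matT Ω d z) / n) *
      (1 - (N : ℝ) / n - ‖z‖ * √(frobSq (matT Ω d z) / n)) ≤ 1 := by
  have hn' : (0 : ℝ) < n := by exact_mod_cast hN.trans_le hNn
  set t := √(frobSq (matT Ω d z) / n) with ht
  have hw := h.w_pos
  have hF0 := h.frobSq_pos hN
  have ht2 : t ^ 2 = frobSq (matT Ω d z) / n := Real.sq_sqrt (by positivity)
  set a := 1 - (N : ℝ) / n - ‖z‖ * t with ha
  rcases le_or_gt a 0 with ha0 | ha0
  · exact (mul_nonpos_of_nonneg_of_nonpos (by positivity) ha0).trans zero_le_one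
  have h1 : n * a ≤ ∑ j, (1 / (1 + d j)).re := by
    rw [h.sum_re_one_div hN]
    have e1 : (z * (matT Ω d z).trace).re ≤ ‖z‖ * (n * t) :=
      (Complex.re_le_norm _).trans (by rw [norm_mul]; gcongr; exact norm_trace_le hNn _)
    have e2 : n * a = n - N - ‖z‖ * (n * t) := by rw [ha]; field_simp
    linarith
  -- Cauchy–Schwarz, to meet the upper bound of `frobSq_mul_sum_le`.
  have h2 : ((n : ℝ) * a) ^ 2 ≤ n * ∑ j, (Complex.normSq (1 + d j))⁻¹ := by
    calc ((n : ℝ) * a) ^ 2 ≤ (∑ j, (1 / (1 + d j)).re) ^ 2 := by gcongr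
      _ ≤ n * ∑ j, ((1 / (1 + d j)).re) ^ 2 := by
        simpa using sq_sum_le_card_mul_sum_sq (s := Finset.univ) (f := fun j => (1 / (1 + d j)).re)
      _ ≤ _ := by
        gcongr with j
        rw [← map_inv₀, ← one_div, Complex.normSq_apply]
        nlinarith [mul_self_nonneg (1 / (1 + d j)).im]
  have h3 := h.frobSq_mul_sum_le hN
  have h4 : (w * t * a) ^ 2 ≤ 1 := by
    have e : (w * t * a) ^ 2 * (n : ℝ) ^ 2 ≤ 1 * (n : ℝ) ^ 2 := by
      calc (w * t * a) ^ 2 * (n : ℝ) ^ 2 = w ^ 2 * (frobSq (matT Ω d z) / n) * (n * a) ^ 2 := by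
            rw [mul_pow, mul_pow, ht2]; ring
        _ ≤ w ^ 2 * (frobSq (matT Ω d z) / n) * (n * ∑ j, (Complex.normSq (1 + d j))⁻¹) := by
            gcongr
        _ = w ^ 2 * frobSq (matT Ω d z) * ∑ j, (Complex.normSq (1 + d j))⁻¹ := by field_simp
        _ ≤ _ := by linarith
    exact le_of_mul_le_mul_right e (by positivity)
  nlinarith [sq_nonneg (w * t * a - 1)]

/-- On the imaginary axis `-Re(z tr T) = y Im tr T` is positive and can be dropped, so no `|z| t` is
lost. With `Re dⱼ ≥ 0`, `Re tr T` is at least `w (1 - c) n t²`, while Cauchy–Schwarz bounds it by `n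
t`. -/
theorem sqrt_frobSq_le_of_re_eq_zero (h : IsSolutionAt Ω w W d z) (hN : 0 < N) (hNn : N ≤ n)
    (hz : z.re = 0) (hd : ∀ i, 0 ≤ (d i).re) :
    w * √(frobSq (matT Ω d z) / n) * (1 - (N : ℝ) / n) ≤ 1 := by
  have hn' : (0 : ℝ) < n := by exact_mod_cast hN.trans_le hNn
  set t := √(frobSq (matT Ω d z) / n) with ht
  have hw := h.w_pos
  have hF0 := h.frobSq_pos hN
  have ht2 : t ^ 2 = frobSq (matT Ω d z) / n := Real.sq_sqrt (by positivity)
  have ht0 : 0 < t := Real.sqrt_pos.2 (by positivity)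
  have h1 : (n : ℝ) - N ≤ ∑ j, (1 / (1 + d j)).re := by
    rw [h.sum_re_one_div hN, Complex.mul_re, hz]
    have := mul_pos h.im_pos (h.im_trace_pos hN)
    linarith
  have h2 := h.re_trace_mul_matT Matrix.PosSemidef.one
  simp only [one_mul, hz, zero_mul, sub_zero, ← re_one_div] at h2
  have h3 : (1 / (n : ℝ)) * ∑ j, (1 / (1 + d j)).re * (w * frobSq (matT Ω d z))
      ≤ (matT Ω d z).trace.re := by
    rw [h2]
    gcongr with j
    · rw [re_one_div]
      exact mul_nonneg (inv_nonneg.2 (Complex.normSq_nonneg _)) (by linarith [hd j])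
    · exact h.sandwich_trace_ge j
  rw [← Finset.sum_mul] at h3
  have h4 : (matT Ω d z).trace.re ≤ n * t := (Complex.re_le_norm _).trans (norm_trace_le hNn _)
  have h5 : (n * t) * (w * t * (1 - (N : ℝ) / n)) ≤ (n * t) * 1 := by
    calc (n * t) * (w * t * (1 - (N : ℝ) / n))
        = (1 / (n : ℝ)) * (((n : ℝ) - N) * (w * (n * t ^ 2))) := by field_simp
      _ ≤ (1 / (n : ℝ)) * ((∑ j, (1 / (1 + d j)).re) * (w * (n * t ^ 2))) := by gcongr
      _ = (1 / (n : ℝ)) * ((∑ j, (1 / (1 + d j)).re) * (w * frobSq (matT Ω d z))) := by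
          rw [ht2]; field_simp
      _ ≤ n * t * 1 := by linarith
  exact le_of_mul_le_mul_left h5 (by positivity)

end IsSolutionAt

/-! ### Comparison of the systems for `Im d` and `1 + Re d`. -/

/-- A comparison principle for nonnegative systems `v = A v + y b`, `u = A u + c`. -/
theorem le_of_nonneg_system {n : ℕ} {A : Fin n → Fin n → ℝ} {u v b c : Fin n → ℝ} {y β : ℝ}
    (hA : ∀ i j, 0 ≤ A i j) (hv : ∀ i, 0 < v i) (hy : 0 < y) (hb : ∀ i, 0 ≤ b i)
    (hbβ : ∀ i, b i ≤ β) (hc : ∀ i, 1 / 2 ≤ c i)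
    (hvA : ∀ i, v i = ∑ j, A i j * v j + y * b i) (huA : ∀ i, u i = ∑ j, A i j * u j + c i)
    (k : Fin n) : v k ≤ 2 * y * β * u k := by
  -- At a minimiser `i` of `u / v`, with minimum `r`, the two systems give `u i ≥ r (v i - y b i) +
  -- 1/2`. As `u i = r v i`, this forces `r y b i ≥ 1/2`, a lower bound for every ratio `u k / v k`.
  -- No sign of `u` is needed.
  obtain ⟨i, -, hi⟩ := Finset.exists_min_image Finset.univ (fun j => u j / v j)
    ⟨k, Finset.mem_univ k⟩
  set r := u i / v i with hr
  have hru : ∀ j, r * v j ≤ u j := fun j => (le_div_iff₀ (hv j)).1 (hi j (Finset.mem_univ j))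
  have h1 : r * (v i - y * b i) + 1 / 2 ≤ u i := by
    rw [huA i]
    refine add_le_add ?_ (hc i)
    rw [hvA i, add_sub_cancel_right, Finset.mul_sum]
    refine Finset.sum_le_sum fun j _ => ?_
    calc r * (A i j * v j) = A i j * (r * v j) := by ring
      _ ≤ _ := mul_le_mul_of_nonneg_left (hru j) (hA i j)
  have h2 : u i = r * v i := by rw [hr, div_mul_cancel₀ _ (hv i).ne']
  have h3 : 1 / 2 ≤ r * (y * b i) := by linarith
  have hr0 : 0 < r := by
    by_contra hneg
    have := mul_nonpos_of_nonpos_of_nonneg (not_lt.1 hneg) (mul_nonneg hy.le (hb i))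
    linarith
  have h4 : r * (y * b i) ≤ r * (y * β) := by gcongr; exact hbβ i
  have hβ : 0 ≤ β := (hb i).trans (hbβ i)
  calc v k = 1 * v k := (one_mul _).symm
    _ ≤ (2 * (r * (y * β))) * v k := mul_le_mul_of_nonneg_right (by linarith) (hv k).le
    _ = 2 * y * β * (r * v k) := by ring
    _ ≤ _ := mul_le_mul_of_nonneg_left (hru k) (by positivity)

namespace IsSolutionAt

variable {n N : ℕ} {Ω : Fin n → Matrix (Fin N) (Fin N) ℂ} {w W : ℝ} {d : Fin n → ℂ} {z : ℂ}

/-- The condition `hzK` keeps the source `1 - x bᵢ` of the system for `1 + Re d` above `1/2`. What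
matters on the right is linearity in `z.im`. -/
theorem im_trace_le (h : IsSolutionAt Ω w W d z) (hN : 0 < N) (hW : 0 ≤ W) (hz : 0 ≤ z.re)
    {K : ℝ} (hK : frobSq (matT Ω d z) / n ≤ K) (hzK : z.re * (W * K) ≤ 1 / 2) (i : Fin n) :
    w / n * (matT Ω d z).trace.im
      ≤ 2 * z.im * (W * K) * (1 + (K + frobSq (Ω i) / n) / 2) := by
  have hn : (1 / (n : ℂ)) = ((1 / (n : ℝ) : ℝ) : ℂ) := by push_cast; rfl
  have hF0 := h.frobSq_pos hN
  have hK0 : 0 ≤ K := le_trans (by positivity) hK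
  set T := matT Ω d z with hT
  have hb : ∀ i, 0 ≤ 1 / (n : ℝ) * (Ω i * (T * Tᴴ)).trace.re := fun i => mul_nonneg (by positivity)
    (Complex.le_def.1 (trace_mul_nonneg (h.posSemidef i) (mul_conjTranspose_posSemidef _))).1
  have hbβ : ∀ i, 1 / (n : ℝ) * (Ω i * (T * Tᴴ)).trace.re ≤ W * K := fun i => by
    have h1 := re_trace_mul_le (h.upper i) (mul_conjTranspose_posSemidef T)
    rw [Matrix.smul_mul, Matrix.trace_smul, one_mul, trace_mul_conjTranspose, smul_eq_mul,
      ← Complex.ofReal_mul, Complex.ofReal_re] at h1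
    calc _ ≤ 1 / (n : ℝ) * (W * frobSq T) := by gcongr
      _ = W * (frobSq T / n) := by ring
      _ ≤ _ := by gcongr
  have key := le_of_nonneg_system
    (A := fun i j => 1 / (n : ℝ) * (1 / (n : ℝ) * ((Complex.normSq (1 + d j))⁻¹ *
      (Ω i * (T * Ω j * Tᴴ)).trace.re)))
    (u := fun i => 1 + (d i).re) (v := fun i => (d i).im) (y := z.im)
    (b := fun i => 1 / (n : ℝ) * (Ω i * (T * Tᴴ)).trace.re)
    (c := fun i => 1 - z.re * (1 / (n : ℝ) * (Ω i * (T * Tᴴ)).trace.re)) (β := W * K)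
    (fun i j => by
      have := (Complex.le_def.1 (trace_mul_nonneg (h.posSemidef i) (h.sandwich_posSemidef j))).1
      have := mul_nonneg (inv_nonneg.2 (Complex.normSq_nonneg (1 + d j))) this
      positivity)
    (h.im_pos' hN) h.im_pos hb hbβ
    (fun i => by
      have : z.re * (1 / (n : ℝ) * (Ω i * (T * Tᴴ)).trace.re) ≤ z.re * (W * K) :=
        mul_le_mul_of_nonneg_left (hbβ i) hz
      linarith)
    (fun i => by
      have := congrArg Complex.im (h.fixed_point i)
      rw [hn, Complex.im_ofReal_mul, h.im_trace_mul_matT (h.posSemidef i), mul_add,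
        Finset.mul_sum, Finset.mul_sum] at this
      rw [this]
      congr 1
      · exact Finset.sum_congr rfl fun j _ => by ring
      · ring)
    (fun i => by
      have := congrArg Complex.re (h.fixed_point i)
      rw [hn, Complex.re_ofReal_mul, h.re_trace_mul_matT (h.posSemidef i), mul_sub,
        Finset.mul_sum, Finset.mul_sum] at this
      rw [this, add_sub_left_comm]
      have e : ∀ p q r s : ℝ, p = q → r = s → p + (1 - r) = q + (1 - s) := by
        rintro p q r s rfl rfl; rfl
      refine e _ _ _ _ (Finset.sum_congr rfl fun j _ => by ring) (by ring))
    i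
  have hre : (d i).re ≤ (K + frobSq (Ω i) / n) / 2 := by
    have h1 := two_mul_re_trace_mul_le (h.posSemidef i).isHermitian T
    have h2 := congrArg Complex.re (h.fixed_point i)
    rw [hn, Complex.re_ofReal_mul] at h2
    rw [h2]
    calc _ ≤ 1 / (n : ℝ) * ((frobSq T + frobSq (Ω i)) / 2) := by gcongr; linarith
      _ = (frobSq T / n + frobSq (Ω i) / n) / 2 := by ring
      _ ≤ _ := by gcongr
  refine (h.im_ge i).trans (key.trans ?_)
  have := h.im_pos
  gcongr

end IsSolutionAt

/-! ### Stieltjes transforms near the real axis. -/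

section Stieltjes

variable {ν : Measure ℝ}

theorem norm_inv_sub_le {z : ℂ} (hz : 0 < z.im) (t : ℝ) : ‖((t : ℂ) - z)⁻¹‖ ≤ z.im⁻¹ := by
  rw [norm_inv]
  refine inv_anti₀ hz ?_
  have := Complex.abs_im_le_norm ((t : ℂ) - z)
  rw [Complex.sub_im, Complex.ofReal_im, zero_sub, abs_neg, abs_of_pos hz] at this
  exact this

theorem measurable_inv_sub (z : ℂ) : Measurable fun t : ℝ => ((t : ℂ) - z)⁻¹ := by fun_prop

theorem integrable_inv_sub [IsFiniteMeasure ν] {z : ℂ} (hz : 0 < z.im) :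
    Integrable (fun t : ℝ => ((t : ℂ) - z)⁻¹) ν :=
  Integrable.of_bound (measurable_inv_sub z).aestronglyMeasurable _
    (Eventually.of_forall (norm_inv_sub_le hz))

theorem stieltjes_im [IsFiniteMeasure ν] {z : ℂ} (hz : 0 < z.im) :
    (stieltjes ν z).im = ∫ t : ℝ, z.im / ((t - z.re) ^ 2 + z.im ^ 2) ∂ν := by
  rw [stieltjes]
  have := integral_im (integrable_inv_sub (ν := ν) hz)
  simp only [RCLike.im_eq_complex_im] at this
  rw [← this]
  congr 1
  ext t
  rw [Complex.inv_im, Complex.normSq_apply]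
  simp [sq]

theorem stieltjes_re [IsFiniteMeasure ν] {z : ℂ} (hz : 0 < z.im) :
    (stieltjes ν z).re = ∫ t : ℝ, (t - z.re) / ((t - z.re) ^ 2 + z.im ^ 2) ∂ν := by
  rw [stieltjes]
  have := integral_re (integrable_inv_sub (ν := ν) hz)
  simp only [RCLike.re_eq_complex_re] at this
  rw [← this]
  congr 1
  ext t
  rw [Complex.inv_re, Complex.normSq_apply]
  simp [sq]

theorem stieltjes_im_nonneg [IsFiniteMeasure ν] {z : ℂ} (hz : 0 < z.im) :
    0 ≤ (stieltjes ν z).im := by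
  rw [stieltjes_im hz]
  exact integral_nonneg fun t => by positivity

theorem stieltjes_re_nonneg [IsFiniteMeasure ν] (hν : ν (Set.Iio 0) = 0) {z : ℂ} (hz : 0 < z.im)
    (hz' : z.re = 0) : 0 ≤ (stieltjes ν z).re := by
  rw [stieltjes_re hz]
  refine integral_nonneg_of_ae ?_
  have : ∀ᵐ t ∂ν, t ∉ Set.Iio (0 : ℝ) := measure_eq_zero_iff_ae_notMem.1 hν
  filter_upwards [this] with t ht
  have ht' : 0 ≤ t := not_lt.1 ht
  simp only [hz', sub_zero, Pi.zero_apply]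
  positivity

theorem continuous_stieltjes_horizontal [IsFiniteMeasure ν] {y : ℝ} (hy : 0 < y) :
    Continuous fun s : ℝ => stieltjes ν (s + y * Complex.I) := by
  refine continuous_of_dominated (bound := fun _ => y⁻¹)
    (fun s => (measurable_inv_sub _).aestronglyMeasurable)
    (fun s => Eventually.of_forall fun t => ?_) (integrable_const _)
    (Eventually.of_forall fun t => ?_)
  · have := norm_inv_sub_le (z := s + y * Complex.I) (by simpa using hy) t
    simpa using this
  · refine Continuous.inv₀ (by fun_prop) fun s h0 => ?_
    have := congrArg Complex.im h0
    simp at this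
    exact hy.ne' this

/-- Markov's inequality: the kernel `y / ((t - x)² + y²)` is at least `1 / (2y)` on the interval. -/
theorem measureReal_Icc_le [IsFiniteMeasure ν] {x y : ℝ} (hy : 0 < y) :
    ν.real (Set.Icc (x - y) (x + y)) ≤ 2 * y * (stieltjes ν (x + y * Complex.I)).im := by
  have hz : 0 < ((x : ℂ) + y * Complex.I).im := by simpa using hy
  have hint := (integrable_inv_sub (ν := ν) hz).im
  have hm := mul_meas_ge_le_integral_of_nonneg (μ := ν)
    (f := fun t : ℝ => y / ((t - x) ^ 2 + y ^ 2))
    (Eventually.of_forall fun t => by simp only [Pi.zero_apply]; positivity)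
    (by
      refine hint.congr (Eventually.of_forall fun t => ?_)
      simp only [RCLike.im_eq_complex_im]
      rw [Complex.inv_im, Complex.normSq_apply]
      simp [sq]) (1 / (2 * y))
  have he := stieltjes_im (ν := ν) hz
  simp only [Complex.add_im, Complex.ofReal_im, Complex.im_ofReal_mul, Complex.I_im, mul_one,
    zero_add, Complex.add_re, Complex.ofReal_re, Complex.re_ofReal_mul, Complex.I_re, mul_zero,
    add_zero] at he
  rw [← he] at hm
  have hsub : Set.Icc (x - y) (x + y) ⊆ {t : ℝ | 1 / (2 * y) ≤ y / ((t - x) ^ 2 + y ^ 2)} := by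
    intro t ht
    rw [Set.mem_ofPred_eq, div_le_div_iff₀ (by positivity) (by positivity)]
    have : (t - x) ^ 2 ≤ y ^ 2 := by
      rw [sq_le_sq, abs_of_pos hy, abs_le]
      constructor <;> linarith [ht.1, ht.2]
    nlinarith
  have h1 := measureReal_mono (μ := ν) hsub
  calc _ ≤ _ := h1
    _ = 2 * y * (1 / (2 * y) * ν.real {t : ℝ | 1 / (2 * y) ≤ y / ((t - x) ^ 2 + y ^ 2)}) := by
      field_simp
    _ ≤ _ := by gcongr

/-- If the Stieltjes transform has imaginary part `O(y)` uniformly above `[0, ε]`, then the measure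
does not charge `[0, ε)`. -/
theorem measure_Ico_eq_zero [IsFiniteMeasure ν] {ε C : ℝ} (hε : 0 < ε)
    (h : ∀ x ∈ Set.Icc 0 ε, ∀ y ∈ Set.Ioc 0 ε, (stieltjes ν (x + y * Complex.I)).im ≤ C * y) :
    ν (Set.Ico 0 ε) = 0 := by
  have hK : ∀ K : ℕ, 0 < K → ν.real (Set.Ico 0 ε) ≤ 2 * C * ε ^ 2 / K := by
    intro K hK
    have hK' : (0 : ℝ) < K := by exact_mod_cast hK
    set y := ε / K with hy
    have hy0 : 0 < y := by positivity
    have hyε : y ≤ ε := div_le_self hε.le (by exact_mod_cast hK)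
    -- Each of the `K` intervals has mass at most `2 C y²` with `y = ε / K`, so the total is `O(1 /
    -- K)`.
    have hsub : Set.Ico 0 ε ⊆ ⋃ k ∈ Finset.range K, Set.Icc (k * y - y) (k * y + y) := by
      intro t ht
      have h0 : 0 ≤ t / y := div_nonneg ht.1 hy0.le
      have h1 := Nat.floor_le h0
      have h2 := Nat.lt_floor_add_one (t / y)
      rw [le_div_iff₀ hy0] at h1
      rw [div_lt_iff₀ hy0] at h2
      simp only [Set.mem_iUnion, Finset.mem_range]
      refine ⟨⌊t / y⌋₊, ?_, ?_, ?_⟩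
      · rw [Nat.floor_lt h0, div_lt_iff₀ hy0, hy, mul_div_cancel₀ _ hK'.ne']
        exact ht.2
      · linarith
      · linarith
    calc ν.real (Set.Ico 0 ε) ≤ _ := measureReal_mono hsub (measure_ne_top ν _)
      _ ≤ ∑ k ∈ Finset.range K, ν.real (Set.Icc (k * y - y) (k * y + y)) :=
        measureReal_biUnion_finset_le _ _
      _ ≤ ∑ k ∈ Finset.range K, 2 * y * (C * y) := by
        refine Finset.sum_le_sum fun k hk => ?_
        have h1 := measureReal_Icc_le (ν := ν) (x := k * y) hy0
        refine h1.trans ?_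
        gcongr
        refine h _ ⟨by positivity, ?_⟩ y ⟨hy0, hyε⟩
        calc (k : ℝ) * y ≤ K * y := by
              gcongr; exact (Finset.mem_range.1 hk).le
          _ = ε := by rw [hy, mul_div_cancel₀ _ hK'.ne']
      _ = 2 * C * ε ^ 2 / K := by
        rw [Finset.sum_const, Finset.card_range, nsmul_eq_mul, hy]
        field_simp
  have h0 : ν.real (Set.Ico 0 ε) ≤ 0 :=
    ge_of_tendsto (tendsto_const_div_atTop_nhds_zero_nat (2 * C * ε ^ 2))
      ((eventually_gt_atTop 0).mono hK)
  exact (measureReal_eq_zero_iff).1 (le_antisymm h0 measureReal_nonneg)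

end Stieltjes

/-! ### The continuity argument and the gap at the origin. -/

theorem mem_offRPlus {z : ℂ} (hz : 0 < z.im) : z ∈ offRPlus := by
  rintro ⟨x, -, rfl⟩
  simp at hz

variable {n N : ℕ} {Ω : Fin n → Matrix (Fin N) (Fin N) ℂ} {w W : ℝ}

theorem IsFixedPointSystem.isSolutionAt {δ : Fin n → ℂ → ℂ} (h : IsFixedPointSystem Ω δ)
    (hw : 0 < w) (hlow : ∀ i, (Ω i - (w : ℂ) • (1 : Matrix (Fin N) (Fin N) ℂ)).PosSemidef)
    (hup : ∀ i, ((W : ℂ) • (1 : Matrix (Fin N) (Fin N) ℂ) - Ω i).PosSemidef)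
    {z : ℂ} (hz : 0 < z.im) : IsSolutionAt Ω w W (fun j => δ j z) z where
  w_pos := hw
  lower := hlow
  upper := hup
  im_nonneg i := by
    obtain ⟨ν, hν, -, hrep⟩ := h.stieltjes_repr i
    rw [hrep z (mem_offRPlus hz)]
    exact stieltjes_im_nonneg hz
  im_pos := hz
  fixed_point i := h.fixed_point i z (mem_offRPlus hz)

theorem continuous_frobSq_matT {δ : Fin n → ℂ → ℂ} (h : IsFixedPointSystem Ω δ) (hN : 0 < N)
    (hsol : ∀ {z : ℂ}, 0 < z.im → IsSolutionAt Ω w W (fun j => δ j z) z) {y : ℝ} (hy : 0 < y) :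
    Continuous fun s : ℝ => frobSq (matT Ω (fun j => δ j (s + y * Complex.I))
      (s + y * Complex.I)) := by
  have him : ∀ s : ℝ, 0 < ((s : ℂ) + y * Complex.I).im := fun s => by simpa using hy
  have hδ : ∀ i, Continuous fun s : ℝ => δ i (s + y * Complex.I) := fun i => by
    obtain ⟨ν, hν, -, hrep⟩ := h.stieltjes_repr i
    refine (continuous_stieltjes_horizontal (ν := ν) hy).congr fun s => ?_
    exact (hrep _ (mem_offRPlus (him s))).symm
  have hne : ∀ i, ∀ s : ℝ, 1 + δ i (s + y * Complex.I) ≠ 0 := fun i s =>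
    (hsol (him s)).one_add_ne_zero hN i
  have hM : Continuous fun s : ℝ => matM Ω (fun j => δ j (s + y * Complex.I))
      (s + y * Complex.I) := by
    unfold matM
    refine Continuous.sub ?_ (by fun_prop)
    refine Continuous.const_smul ?_ (1 / (n : ℂ))
    refine continuous_finsetSum _ fun i _ => ?_
    have h1 : Continuous fun s : ℝ => 1 + δ i (s + y * Complex.I) := continuous_const.add (hδ i)
    exact (continuous_const.div h1 (hne i)).smul continuous_const
  have hT : Continuous fun s : ℝ => matT Ω (fun j => δ j (s + y * Complex.I))
      (s + y * Complex.I) := by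
    simp_rw [matT_eq, Matrix.inv_def, Ring.inverse_eq_inv]
    refine Continuous.smul (hM.matrix_det.inv₀ fun s => ?_) hM.matrix_adjugate
    exact isUnit_iff_ne_zero.1 ((Matrix.isUnit_iff_isUnit_det _).1 (hsol (him s)).isUnit_matM)
  unfold frobSq
  exact continuous_finsetSum _ fun i _ => continuous_finsetSum _ fun j _ =>
    ((hT.matrix_elem i j).norm.pow 2)

/-- The deterministic equivalent measure does not charge `[0, ε)` as soon as
`ε ≤ w² (1 - N / n)² / (16 W)`. -/
theorem IsDeterministicEquivalent.measure_Ico_eq_zero {μ : Measure ℝ}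
    (h : IsDeterministicEquivalent Ω μ) (hN : 0 < N) (hNn : N < n) (hw : 0 < w) (hwW : w ≤ W)
    (hlow : ∀ i, (Ω i - (w : ℂ) • (1 : Matrix (Fin N) (Fin N) ℂ)).PosSemidef)
    (hup : ∀ i, ((W : ℂ) • (1 : Matrix (Fin N) (Fin N) ℂ) - Ω i).PosSemidef)
    {ε : ℝ} (hε : 0 < ε) (hεw : 16 * W * ε ≤ w ^ 2 * (1 - (N : ℝ) / n) ^ 2) :
    μ (Set.Ico 0 ε) = 0 := by
  have := h.isProbabilityMeasure
  obtain ⟨δ, hδ, hμ⟩ := h.stieltjes_eq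
  have hn : 0 < n := hN.trans hNn
  have hn' : (0 : ℝ) < n := by exact_mod_cast hn
  have hN' : (0 : ℝ) < N := by exact_mod_cast hN
  have hW : 0 < W := hw.trans_le hwW
  have him : ∀ x : ℝ, ∀ {y : ℝ}, 0 < y → 0 < ((x : ℂ) + y * Complex.I).im :=
    fun s y hy => by simpa using hy
  have hsol : ∀ {z : ℂ}, 0 < z.im → IsSolutionAt Ω w W (fun j => δ j z) z := fun hz =>
    hδ.isSolutionAt hw hlow hup hz
  set a := 1 - (N : ℝ) / n with ha
  have ha0 : 0 < a := by
    rw [ha, sub_pos, div_lt_one hn']; exact_mod_cast hNn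
  -- The square of the barrier `2 / (w a)`, twice the bound available on the imaginary axis.
  set K := 4 / (w * a) ^ 2 with hK
  have hfrob : ∀ x ∈ Set.Icc 0 ε, ∀ y ∈ Set.Ioc 0 ε,
      frobSq (matT Ω (fun j => δ j (x + y * Complex.I)) (x + y * Complex.I)) / n ≤ K := by
    intro x hx y hy
    set f : ℝ → ℝ := fun s => √(frobSq (matT Ω (fun j => δ j (s + y * Complex.I))
      (s + y * Complex.I)) / n) with hf
    have hfc : Continuous f := by
      exact ((continuous_frobSq_matT hδ hN hsol hy.1).div_const _).sqrt
    have hf0 : f 0 ≤ 2 / (w * a) := by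
      have h1 := (hsol (him 0 hy.1)).sqrt_frobSq_le_of_re_eq_zero hN hNn.le (by simp)
        fun i => by
          obtain ⟨ν, hν, hν0, hrep⟩ := hδ.stieltjes_repr i
          rw [hrep _ (mem_offRPlus (him 0 hy.1))]
          exact stieltjes_re_nonneg hν0 (him 0 hy.1) (by simp)
      rw [le_div_iff₀ (by positivity)]
      have h1 : w * f 0 * a ≤ 1 := h1
      linarith
    have hfx : f x ≤ 2 / (w * a) := by
      by_contra hlt
      -- If `f` exceeded the barrier it would take that exact value at some `s`; there the a priori
      -- inequality would read `3/2 ≤ 1`, since `|z| ≤ 2ε`.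
      obtain ⟨s, hs, hfs⟩ := intermediate_value_Icc hx.1 hfc.continuousOn
        ⟨hf0, (not_le.1 hlt).le⟩
      have h1 := (hsol (him s hy.1)).sqrt_frobSq_mul_le hN hNn.le
      have h1 : w * f s * (a - ‖(s : ℂ) + y * Complex.I‖ * f s) ≤ 1 := h1
      have hnorm : ‖(s : ℂ) + y * Complex.I‖ ≤ 2 * ε := by
        refine (norm_add_le _ _).trans ?_
        rw [norm_mul, Complex.norm_I, mul_one, Complex.norm_real, Complex.norm_real,
          Real.norm_of_nonneg hs.1, Real.norm_of_nonneg hy.1.le]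
        linarith [hs.2, hx.2, hy.2]
      rw [hfs] at h1
      have h2 : w * (2 / (w * a)) * (a - 2 * ε * (2 / (w * a))) ≤ 1 := by
        refine le_trans ?_ h1
        gcongr
      have h3 : w * (2 / (w * a)) * (a - 2 * ε * (2 / (w * a)))
          = 2 - 8 * (w * ε) / (w ^ 2 * a ^ 2) := by field_simp; ring
      have h4 : 8 * (w * ε) / (w ^ 2 * a ^ 2) ≤ 1 / 2 := by
        rw [div_le_iff₀ (by positivity)]
        have : w * ε ≤ W * ε := by gcongr
        linarith
      linarith
    have h0 : 0 ≤ frobSq (matT Ω (fun j => δ j (x + y * Complex.I)) (x + y * Complex.I)) / n :=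
      div_nonneg ((hsol (him x hy.1)).frobSq_pos hN).le hn'.le
    calc _ = f x ^ 2 := (Real.sq_sqrt h0).symm
      _ ≤ (2 / (w * a)) ^ 2 := by gcongr
      _ = K := by rw [hK, div_pow]; norm_num
  have hWK : ε * (W * K) ≤ 1 / 2 := by
    have : ε * (W * K) = 4 * (W * ε) / (w ^ 2 * a ^ 2) := by rw [hK]; field_simp
    rw [this, div_le_iff₀ (by positivity)]
    have := mul_pos hW hε
    linarith
  have hK0 : 0 ≤ K := by positivity
  refine CorrelatedGaussian.measure_Ico_eq_zero (C := 1 / (N : ℝ) *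
    ((n : ℝ) / w * (2 * (W * K) * (1 + (K + frobSq (Ω ⟨0, hn⟩) / n) / 2)))) hε fun x hx y hy => ?_
  have hz := him x hy.1
  have h1 := (hsol hz).im_trace_le hN hW.le (by simpa using hx.1) (hfrob x hx y hy)
    (by
      have : x * (W * K) ≤ ε * (W * K) := by gcongr; exact hx.2
      simpa using this.trans hWK) ⟨0, hn⟩
  have hNc : (1 / (N : ℂ)) = ((1 / (N : ℝ) : ℝ) : ℂ) := by push_cast; rfl
  rw [hμ _ (mem_offRPlus hz), hNc, Complex.im_ofReal_mul, mul_assoc]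
  gcongr
  have e : ((x : ℂ) + y * Complex.I).im = y := by simp
  rw [e] at h1
  set V := (matT Ω (fun j => δ j (x + y * Complex.I)) (x + y * Complex.I)).trace.im
  calc V = n / w * (w / n * V) := by field_simp
    _ ≤ n / w * (2 * y * (W * K) * (1 + (K + frobSq (Ω ⟨0, hn⟩) / n) / 2)) := by gcongr
    _ = _ := by ring

theorem IsDeterministicEquivalent.Icc_inter_support_eq_empty {Nbar : ℕ}
    {Θ : Fin n → Matrix (Fin N) (Fin Nbar) ℂ} {μ : Measure ℝ}
    (h : IsDeterministicEquivalent (fun i => cov (Θ i)) μ) (hN : 0 < N) (hNn : N < n)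
    (hw : 0 < w) (hwW : w ≤ W) (hlow : ∀ i j, w ≤ (cov_isHermitian (Θ i)).eigenvalues j)
    (hup : ∀ i j, (cov_isHermitian (Θ i)).eigenvalues j ≤ W)
    {a : ℝ} (ha : 0 < a) (haN : a ≤ 1 - (N : ℝ) / n) :
    Set.Icc 0 (w ^ 2 * a ^ 2 / (32 * W)) ∩ μ.support = ∅ := by
  have hW : 0 < W := hw.trans_le hwW
  set ε := w ^ 2 * a ^ 2 / (32 * W) with hε
  have hε0 : 0 < ε := by positivity
  -- Doubling `ε` (hence `32` in place of `16`) puts the closed interval inside the open null set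
  -- `(-∞, 2ε)`, which the support avoids.
  have h1 := h.measure_Ico_eq_zero (ε := 2 * ε) hN hNn hw hwW
    (fun i => posSemidef_sub_smul_one _ (hlow i)) (fun i => posSemidef_smul_one_sub _ (hup i))
    (by positivity) (by
    calc 16 * W * (2 * ε) = w ^ 2 * a ^ 2 := by rw [hε]; field_simp; norm_num
      _ ≤ _ := by gcongr)
  have h2 : μ (Set.Iio (2 * ε)) = 0 := by
    refine measure_mono_null (fun t ht => ?_) (measure_union_null h.carried h1)
    rcases lt_or_ge t 0 with h0 | h0
    · exact Or.inl h0
    · exact Or.inr ⟨h0, ht⟩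
  refine Set.disjoint_iff_inter_eq_empty.1 (Set.disjoint_left.2 fun t ht => ?_)
  exact Measure.subset_compl_support_of_isOpen isOpen_Iio h2
    (show t < 2 * ε by linarith [ht.2])

end CorrelatedGaussian

end

/-! ### Uniformity in `N`. -/

theorem mainTheorem2
    (n Nbar : ℕ → ℕ)
    (hn : ∀ N, N ≤ n N) (hNbar : ∀ N, N ≤ Nbar N)
    (hc_pos : 0 < liminf (fun N : ℕ => (N : ℝ) / (n N : ℝ)) atTop)
    (hc_lt : limsup (fun N : ℕ => (N : ℝ) / (n N : ℝ)) atTop < 1)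
    (Θ : (N : ℕ) → Fin (n N) → Matrix (Fin N) (Fin (Nbar N)) ℂ)
    (hw_min : 0 < CorrelatedGaussian.wMin Θ)
    (hw_max : CorrelatedGaussian.wMax Θ < ⊤)
    (μ : ℕ → Measure ℝ)
    (hμ : ∀ N, 1 ≤ N → CorrelatedGaussian.IsDeterministicEquivalent
      (fun i => CorrelatedGaussian.cov (Θ N i)) (μ N)) :
    (∀ N, 1 ≤ N → N < n N →
      0 ∉ (μ N).support ∧ ∃ ε : ℝ, 0 < ε ∧ Set.Icc 0 ε ∩ (μ N).support = ∅) ∧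
    ∃ ε : ℝ, 0 < ε ∧ ∀ᶠ N in atTop, Set.Icc 0 ε ∩ (μ N).support = ∅ := by
  obtain ⟨w, hw0, hw⟩ := EReal.lt_iff_exists_real_btwn.1 hw_min
  obtain ⟨W', hW', -⟩ := EReal.lt_iff_exists_real_btwn.1 hw_max
  have hw0 : 0 < w := by exact_mod_cast hw0
  set W := max w W'
  have hW0 : 0 < W := hw0.trans_le (le_max_left _ _)
  have hlow : ∀ N i j, w ≤ (CorrelatedGaussian.cov_isHermitian (Θ N i)).eigenvalues j :=
    fun N i j => by
      have : CorrelatedGaussian.wMin Θ ≤ _ :=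
        (iInf_le _ N).trans ((iInf_le _ i).trans (iInf_le _ j))
      exact_mod_cast hw.le.trans this
  have hup : ∀ N i j, (CorrelatedGaussian.cov_isHermitian (Θ N i)).eigenvalues j ≤ W :=
    fun N i j => by
      have h1 : _ ≤ CorrelatedGaussian.wMax Θ := le_iSup_of_le N (le_iSup_of_le i (le_iSup
        (fun j => (((CorrelatedGaussian.cov_isHermitian (Θ N i)).eigenvalues j : ℝ) : EReal)) j))
      have h2 : (CorrelatedGaussian.cov_isHermitian (Θ N i)).eigenvalues j ≤ W' := by
        exact_mod_cast h1.trans hW'.le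
      exact h2.trans (le_max_right _ _)
  -- The gap depends on `N` only through `a`; the positivity of `a` already excludes `N = n N`.
  have key : ∀ N : ℕ, 1 ≤ N → ∀ a : ℝ, 0 < a → a ≤ 1 - (N : ℝ) / n N →
      Set.Icc 0 (w ^ 2 * a ^ 2 / (32 * W)) ∩ (μ N).support = ∅ := fun N hN a ha haN => by
    have hlt : N < n N := by
      refine (hn N).lt_of_ne fun he => ?_
      have : (N : ℝ) ≠ 0 := by positivity
      rw [← he, div_self this] at haN
      linarith
    exact (hμ N hN).Icc_inter_support_eq_empty hN hlt hw0 (le_max_left _ _) (hlow N) (hup N) ha haN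
  refine ⟨fun N hN hNn => ?_, ?_⟩
  · have hn' : (0 : ℝ) < n N := by exact_mod_cast (Nat.zero_le N).trans_lt hNn
    have ha : 0 < 1 - (N : ℝ) / n N := by
      rw [sub_pos, div_lt_one hn']; exact_mod_cast hNn
    have h1 := key N hN _ ha le_rfl
    have hε : 0 < w ^ 2 * (1 - (N : ℝ) / n N) ^ 2 / (32 * W) := by positivity
    refine ⟨fun h0 => ?_, _, hε, h1⟩
    exact (Set.eq_empty_iff_forall_notMem.1 h1) 0 ⟨⟨le_rfl, hε.le⟩, h0⟩
  -- Eventually `N / n N < c`, so `a = 1 - c` serves for all large `N`.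
  · obtain ⟨c, hc, hc1⟩ := exists_between hc_lt
    have hbdd : IsBoundedUnder (· ≤ ·) atTop (fun N : ℕ => (N : ℝ) / (n N : ℝ)) :=
      isBoundedUnder_of ⟨1, fun N => div_le_one_of_le₀ (by exact_mod_cast hn N) (by positivity)⟩
    have hev := eventually_lt_of_limsup_lt hc hbdd
    refine ⟨w ^ 2 * (1 - c) ^ 2 / (32 * W), ?_, ?_⟩
    · have : 0 < 1 - c := by linarith
      positivity
    · filter_upwards [hev, eventually_ge_atTop 1] with N h1 h2
      exact key N h2 _ (by linarith) (by linarith)
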